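/- Let $\mathbb K\in\{\mathbb R,\mathbb C\}$ and let $X$ be a Hausdorff space. An (F) Banach bundle $\pi:\mathcal E\to X$ is a continuous open surjection whose fibers $\mathcal E_x=\pi^{-1}(x)$ are Banach spaces over $\mathbb K$, such that scalar multiplication $\mathbb K\times\mathcal E\to\mathcal E$, addition $\mathcal E\times_X\mathcal E\to\mathcal E$ and the norm $\mathcal E\to\mathbb R_{\ge 0}$ are continuous, and such that for each $x\in X$ the sets $\{p\in\mathcal E : \pi(p)\in U,\ \|p\|<\varepsilon\}$, with $U$ a neighborhood of $x$ and $\varepsilon>0$, form a neighborhood basis of $0_x\in\mathcal E$. It is $n$-homogeneous ($n\in\mathbb Z_{\ge 0}$) if $\dim\mathcal E_x=n$ for all $x\in X$. It is a Hilbert bundle if its fibers are Hilbert spaces. A Hilbert-bundle renorming of $\mathcal E$ is an (F) Hilbert bundle $\mathcal E'\to X$ with a homeomorphism $\mathcal E\to\mathcal E'$ over $X$ that is linear on each fiber. Write $\Gamma_b(\mathcal E)$ for the space of bounded continuous sections of $\mathcal E$ and, if $X$ is locally compact, $\Gamma_0(\mathcal E)$ for the space of continuous sections vanishing at infinity, both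 with the supremum norm. Write $C_0(X)$ for the $\mathbb K$-valued continuous functions on $X$ vanishing at infinity, acting pointwise on $\Gamma_0(\mathcal E)$. Let $\mathcal E\to X$ be an $n$-homogeneous (F) Banach bundle. (1) If every point of $X$ has a closed paracompact neighborhood, then $\mathcal E$ is boundedly unitarizable: it has a Hilbert-bundle renorming $\mathcal E\cong\mathcal E'$ which induces a topological linear isomorphism $\Gamma_b(\mathcal E)\cong\Gamma_b(\mathcal E')$. (2) If $X$ is locally compact, then $\mathcal E$ is $0$-boundedly unitarizable: it has a Hilbert-bundle renorming $\mathcal E\cong\mathcal E'$ which induces a topological linear isomorphism $\Gamma_0(\mathcal E)\cong\Gamma_0(\mathcal E')$. Moreover, there is a $C_0(X)$-valued inner product $\langle\cdot\mid\cdot\rangle$ on $\Gamma_0(\mathcal E)$ which makes it a Hilbert $C_0(X)$-module (that is, $\Gamma_0(\mathcal E)$ is complete for the norm $s\mapsto\|\langle s\mid s\rangle\|^{1/2}$), and this norm is equivalent to the supremum norm on $\Gamma_0(\mathcal E)$. -/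

import Mathlib

open Topology Filter Bundle
open scoped ENNReal ZeroAtInfty ComplexOrder

noncomputable section

/-- The total space of a family of fibers `E x`, `x : X`, with projection `p ↦ p.proj`.
(The first argument of Mathlib's `Bundle.TotalSpace` is only a label, not used here.) -/
abbrev BundleTotal {X : Type*} (E : X → Type*) : Type _ := Bundle.TotalSpace Unit E

/-- (F) Banach bundles over `X`: the fibers are Banach spaces, the total space has a topology
for which the projection is continuous and open, the vector space operations and the norm are
continuous, and the tubes `{p | p.proj ∈ U, ‖p‖ < ε}` are a neighborhood basis at `0 ∈ E x`.
The projection is automatically onto. In `continuous_add`, the fiber product `E ×_X E` carries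
the topology induced by `BundleTotal E × BundleTotal E`. -/
class IsFellBundle (𝕜 : Type*) [RCLike 𝕜] {X : Type*} [TopologicalSpace X] (E : X → Type*)
    [∀ x, NormedAddCommGroup (E x)] [∀ x, NormedSpace 𝕜 (E x)]
    [TopologicalSpace (BundleTotal E)] : Prop where
  complete_fiber : ∀ x, CompleteSpace (E x)
  continuous_proj : Continuous (fun p : BundleTotal E => p.proj)
  isOpenMap_proj : IsOpenMap (fun p : BundleTotal E => p.proj)
  continuous_smul :
    Continuous (fun q : 𝕜 × BundleTotal E => (⟨q.2.proj, q.1 • q.2.snd⟩ : BundleTotal E))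
  continuous_add :
    Continuous (fun q : Bundle.TotalSpace (Unit × Unit) (E ×ᵇ E) =>
      (⟨q.proj, q.snd.1 + q.snd.2⟩ : BundleTotal E))
  continuous_norm : Continuous (fun p : BundleTotal E => ‖p.snd‖)
  hasBasis_nhds_zero : ∀ x : X,
    (𝓝 (⟨x, 0⟩ : BundleTotal E)).HasBasis (fun Uε : Set X × ℝ => Uε.1 ∈ 𝓝 x ∧ 0 < Uε.2)
      (fun Uε => {p : BundleTotal E | p.proj ∈ Uε.1 ∧ ‖p.snd‖ < Uε.2})

/-- All fibers have the same finite dimension `n`. -/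
def IsHomogeneousBundle (𝕜 : Type*) [RCLike 𝕜] {X : Type*} (E : X → Type*)
    [∀ x, NormedAddCommGroup (E x)] [∀ x, NormedSpace 𝕜 (E x)] (n : ℕ) : Prop :=
  ∀ x, FiniteDimensional 𝕜 (E x) ∧ Module.finrank 𝕜 (E x) = n

/-- Every point has a closed paracompact neighborhood. -/
def IsLocallyParacompact (X : Type*) [TopologicalSpace X] : Prop :=
  ∀ x : X, ∃ N ∈ 𝓝 x, IsClosed N ∧ ParacompactSpace N

/-- Continuity of a section `x ↦ s x ∈ E x`. -/
def IsContinuousSection {X : Type*} [TopologicalSpace X] {E : X → Type*}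
    [TopologicalSpace (BundleTotal E)] (s : ∀ x, E x) : Prop :=
  Continuous (fun x => (⟨x, s x⟩ : BundleTotal E))

theorem IsContinuousSection.smul (𝕜 : Type*) [RCLike 𝕜] {X : Type*} [TopologicalSpace X]
    {E : X → Type*} [∀ x, NormedAddCommGroup (E x)] [∀ x, NormedSpace 𝕜 (E x)]
    [TopologicalSpace (BundleTotal E)] [IsFellBundle 𝕜 E]
    {f : X → 𝕜} (hf : Continuous f) {s : ∀ x, E x}
    (hs : IsContinuousSection s) : IsContinuousSection (fun x => f x • s x) :=
  (IsFellBundle.continuous_smul (𝕜 := 𝕜) (E := E)).comp (hf.prodMk hs)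

theorem IsContinuousSection.add (𝕜 : Type*) [RCLike 𝕜] {X : Type*} [TopologicalSpace X]
    {E : X → Type*} [∀ x, NormedAddCommGroup (E x)] [∀ x, NormedSpace 𝕜 (E x)]
    [TopologicalSpace (BundleTotal E)] [IsFellBundle 𝕜 E] {s t : ∀ x, E x}
    (hs : IsContinuousSection s) (ht : IsContinuousSection t) :
    IsContinuousSection (fun x => s x + t x) := by
  have h : Continuous
      (fun x => (⟨x, (s x, t x)⟩ : Bundle.TotalSpace (Unit × Unit) (E ×ᵇ E))) :=
    (FiberBundle.Prod.isInducing_diag Unit E Unit E).continuous_iff.2 (hs.prodMk ht)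
  exact (IsFellBundle.continuous_add (𝕜 := 𝕜) (E := E)).comp h

theorem IsContinuousSection.zero (𝕜 : Type*) [RCLike 𝕜] {X : Type*} [TopologicalSpace X]
    (E : X → Type*) [∀ x, NormedAddCommGroup (E x)] [∀ x, NormedSpace 𝕜 (E x)]
    [TopologicalSpace (BundleTotal E)] [IsFellBundle 𝕜 E] :
    IsContinuousSection (fun x => (0 : E x)) := by
  refine continuous_iff_continuousAt.2 fun x => ?_
  refine ((IsFellBundle.hasBasis_nhds_zero (𝕜 := 𝕜) (E := E) x).tendsto_right_iff).2 ?_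
  rintro ⟨U, ε⟩ ⟨hU, hε⟩
  filter_upwards [hU] with y hy
  exact ⟨hy, by simpa using hε⟩

section Sections

variable (𝕜 : Type*) [RCLike 𝕜] {X : Type*} [TopologicalSpace X] (E : X → Type*)
  [∀ x, NormedAddCommGroup (E x)] [∀ x, NormedSpace 𝕜 (E x)]
  [TopologicalSpace (BundleTotal E)] [IsFellBundle 𝕜 E]

/-- `Γ_b(E)`: the bounded continuous sections, with the supremum norm
(`lp E ∞` is the space of all bounded families `(s x)`, normed by `⨆ x, ‖s x‖`). -/
def BoundedSections : Submodule 𝕜 (lp E ∞) where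
  carrier := {s | IsContinuousSection (fun x => s x)}
  add_mem' {_ _} hs ht := IsContinuousSection.add 𝕜 hs ht
  zero_mem' := IsContinuousSection.zero 𝕜 E
  smul_mem' c _ hs := IsContinuousSection.smul 𝕜 (continuous_const (y := c)) hs

/-- `Γ_0(E)`: the continuous sections vanishing at infinity (these are bounded), with the
supremum norm. -/
def ZeroSections : Submodule 𝕜 (lp E ∞) where
  carrier := {s | IsContinuousSection (fun x => s x) ∧
    Tendsto (fun x => ‖s x‖) (cocompact X) (𝓝 0)}
  add_mem' {s t} hs ht := by
    refine ⟨IsContinuousSection.add 𝕜 hs.1 ht.1, ?_⟩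
    refine squeeze_zero (fun x => norm_nonneg _) (fun x => norm_add_le (s x) (t x)) ?_
    simpa using hs.2.add ht.2
  zero_mem' := ⟨IsContinuousSection.zero 𝕜 E, by simpa using tendsto_const_nhds (x := (0 : ℝ))⟩
  smul_mem' c s hs := by
    refine ⟨IsContinuousSection.smul 𝕜 (continuous_const (y := c)) hs.1, ?_⟩
    have h : Tendsto (fun x => ‖c‖ * ‖s x‖) (cocompact X) (𝓝 0) := by
      simpa using hs.2.const_mul ‖c‖
    refine h.congr fun x => ?_
    simp [norm_smul]

/-- The pointwise action of `C_0(X)` on `Γ_0(E)`: `(f • s) x = f x • s x`. -/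
instance ZeroSections.instSMul : SMul C₀(X, 𝕜) (ZeroSections 𝕜 E) where
  smul f s :=
    ⟨⟨fun x => f x • (s : lp E ∞) x, memℓp_infty ⟨‖f.toBCF‖ * ‖(s : lp E ∞)‖, by
        rintro _ ⟨x, rfl⟩
        simp only [norm_smul]
        exact mul_le_mul (f.toBCF.norm_coe_le_norm x)
          (lp.norm_apply_le_norm ENNReal.top_ne_zero _ x) (norm_nonneg _) (norm_nonneg _)⟩⟩, by
      refine ⟨IsContinuousSection.smul 𝕜 f.continuous s.2.1, ?_⟩
      have hf : Tendsto (fun x => ‖f x‖) (cocompact X) (𝓝 0) := by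
        simpa using (zero_at_infty f).norm
      have h : Tendsto (fun x => ‖f x‖ * ‖(s : lp E ∞) x‖) (cocompact X) (𝓝 0) := by
        simpa using hf.mul s.2.2
      refine h.congr fun x => ?_
      simp [norm_smul]⟩

end Sections

/-- A Hilbert-bundle renorming of `E`: an (F) Banach bundle `E'` over the same base whose fibers
are Hilbert spaces, with a homeomorphism of total spaces over the identity of the base which is
linear on each fiber. -/
structure HilbertRenorming (𝕜 : Type*) [RCLike 𝕜] {X : Type*} [TopologicalSpace X]
    (E : X → Type*) [∀ x, NormedAddCommGroup (E x)] [∀ x, NormedSpace 𝕜 (E x)]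
    [TopologicalSpace (BundleTotal E)] where
  Fiber : X → Type*
  [normedFiber : ∀ x, NormedAddCommGroup (Fiber x)]
  [innerFiber : ∀ x, InnerProductSpace 𝕜 (Fiber x)]
  [topTotal : TopologicalSpace (BundleTotal Fiber)]
  [isFell : IsFellBundle 𝕜 Fiber]
  equiv : ∀ x, E x ≃ₗ[𝕜] Fiber x
  isHomeomorph_equiv :
    IsHomeomorph (fun p : BundleTotal E => (⟨p.proj, equiv p.proj p.snd⟩ : BundleTotal Fiber))

attribute [instance] HilbertRenorming.normedFiber HilbertRenorming.innerFiber
  HilbertRenorming.topTotal HilbertRenorming.isFell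

section Unitarizable

universe u v

variable (𝕜 : Type*) [RCLike 𝕜] {X : Type u} [TopologicalSpace X] (E : X → Type v)
  [∀ x, NormedAddCommGroup (E x)] [∀ x, NormedSpace 𝕜 (E x)]
  [TopologicalSpace (BundleTotal E)] [IsFellBundle 𝕜 E]

/-- There is a Hilbert-bundle renorming that induces a topological isomorphism of the spaces of
bounded sections. -/
def IsBoundedlyUnitarizable : Prop :=
  ∃ (R : HilbertRenorming.{_, u, v, v} 𝕜 E)
    (T : BoundedSections 𝕜 E ≃L[𝕜] BoundedSections 𝕜 R.Fiber),
    ∀ (s : BoundedSections 𝕜 E) (x : X),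
      (T s : lp R.Fiber ∞) x = R.equiv x ((s : lp E ∞) x)

/-- There is a Hilbert-bundle renorming that induces a topological isomorphism of the spaces of
sections vanishing at infinity. -/
def IsZeroBoundedlyUnitarizable : Prop :=
  ∃ (R : HilbertRenorming.{_, u, v, v} 𝕜 E)
    (T : ZeroSections 𝕜 E ≃L[𝕜] ZeroSections 𝕜 R.Fiber),
    ∀ (s : ZeroSections 𝕜 E) (x : X),
      (T s : lp R.Fiber ∞) x = R.equiv x ((s : lp E ∞) x)

/-- A `C_0(X)`-valued inner product on `Γ_0(E)`, linear in the second variable. -/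
structure ZeroSectionsInner where
  inner : ZeroSections 𝕜 E → ZeroSections 𝕜 E → C₀(X, 𝕜)
  inner_add_right : ∀ s t₁ t₂, inner s (t₁ + t₂) = inner s t₁ + inner s t₂
  inner_smul_right : ∀ (c : 𝕜) s t, inner s (c • t) = c • inner s t
  inner_module_smul_right : ∀ (f : C₀(X, 𝕜)) s t, inner s (f • t) = f * inner s t
  star_inner : ∀ s t, star (inner s t) = inner t s
  inner_self_nonneg : ∀ s x, 0 ≤ inner s s x
  inner_self_eq_zero : ∀ s, inner s s = 0 → s = 0

variable {𝕜 E}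

/-- The norm `‖⟨s, s⟩‖ ^ (1/2)` induced by a `C_0(X)`-valued inner product. -/
def ZeroSectionsInner.norm (I : ZeroSectionsInner 𝕜 E) (s : ZeroSections 𝕜 E) : ℝ :=
  Real.sqrt ‖I.inner s s‖

/-- The inner product makes `Γ_0(E)` a Hilbert `C_0(X)`-module: the induced norm is complete. -/
def ZeroSectionsInner.IsHilbertModule (I : ZeroSectionsInner 𝕜 E) : Prop :=
  ∀ s : ℕ → ZeroSections 𝕜 E,
    (∀ ε > 0, ∃ N, ∀ m ≥ N, ∀ n ≥ N, I.norm (s m - s n) < ε) →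
    ∃ t, Tendsto (fun n => I.norm (s n - t)) atTop (𝓝 0)

/-- The induced norm is equivalent to the supremum norm of `Γ_0(E)`. -/
def ZeroSectionsInner.IsEquivalentToSupNorm (I : ZeroSectionsInner 𝕜 E) : Prop :=
  ∃ c > 0, ∃ C > 0, ∀ s : ZeroSections 𝕜 E, c * ‖s‖ ≤ I.norm s ∧ I.norm s ≤ C * ‖s‖

end Unitarizable

end

open MeasureTheory Metric in
/-- Scaling of the integral over a ball of a function that is homogeneous of degree two. -/
theorem setIntegral_closedBall_of_homogeneous {D : Type*} [NormedAddCommGroup D]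
    [NormedSpace ℝ D] [MeasurableSpace D] [BorelSpace D] [FiniteDimensional ℝ D] (μ : Measure D)
    [μ.IsAddHaarMeasure] {φ : D → ℝ} (hφ : ∀ r : ℝ, ∀ f, φ (r • f) = r ^ 2 * φ f)
    {r : ℝ} (hr : 0 < r) :
    ∫ f in closedBall (0 : D) r, φ f ∂μ =
      r ^ (Module.finrank ℝ D + 2) * ∫ f in closedBall (0 : D) 1, φ f ∂μ := by
  have h := Measure.setIntegral_comp_smul_of_pos μ φ (closedBall (0 : D) 1) hr
  rw [smul_unitClosedBall_of_nonneg hr.le] at h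
  simp only [hφ, integral_const_mul, smul_eq_mul] at h
  have hr' : r ^ Module.finrank ℝ D ≠ 0 := by positivity
  rw [eq_inv_mul_iff_mul_eq₀ hr'] at h
  rw [← h]
  ring

open MeasureTheory Metric in
/-- The average over a set lying between two balls is comparable to that over the unit ball. -/
theorem setAverage_mem_Icc_of_between_closedBalls {D : Type*} [NormedAddCommGroup D]
    [NormedSpace ℝ D] [MeasurableSpace D] [BorelSpace D] [FiniteDimensional ℝ D] (μ : Measure D)
    [μ.IsAddHaarMeasure] {φ : D → ℝ} (hφ : ∀ r : ℝ, ∀ f, φ (r • f) = r ^ 2 * φ f)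
    (hc : Continuous φ) (h0 : ∀ f, 0 ≤ φ f) {K : Set D} {a b : ℝ} (ha : 0 < a) (hb : 0 < b)
    (haK : closedBall (0 : D) a ⊆ K) (hKb : K ⊆ closedBall (0 : D) b) :
    ⨍ f in K, φ f ∂μ ∈ Set.Icc
      (a ^ (Module.finrank ℝ D + 2) / b ^ Module.finrank ℝ D *
        ⨍ f in closedBall (0 : D) 1, φ f ∂μ)
      (b ^ (Module.finrank ℝ D + 2) / a ^ Module.finrank ℝ D *
        ⨍ f in closedBall (0 : D) 1, φ f ∂μ) := by
  set d := Module.finrank ℝ D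
  have : ProperSpace D := FiniteDimensional.proper ℝ D
  have hint : ∀ r : ℝ, IntegrableOn φ (closedBall (0 : D) r) μ := fun r =>
    hc.continuousOn.integrableOn_compact (isCompact_closedBall _ _)
  have hfin : ∀ r : ℝ, μ (closedBall (0 : D) r) ≠ ∞ := fun r =>
    (isCompact_closedBall _ _).measure_ne_top
  have hKfin : μ K ≠ ∞ := ne_top_of_le_ne_top (hfin b) (measure_mono hKb)
  have hI1 : ∫ f in closedBall (0 : D) a, φ f ∂μ ≤ ∫ f in K, φ f ∂μ :=
    setIntegral_mono_set ((hint b).mono_set hKb) (Eventually.of_forall h0)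
      (LE.le.eventuallyLE haK)
  have hI2 : ∫ f in K, φ f ∂μ ≤ ∫ f in closedBall (0 : D) b, φ f ∂μ :=
    setIntegral_mono_set (hint b) (Eventually.of_forall h0) (LE.le.eventuallyLE hKb)
  have hm1 : μ.real (closedBall (0 : D) a) ≤ μ.real K := measureReal_mono haK hKfin
  have hm2 : μ.real K ≤ μ.real (closedBall (0 : D) b) := measureReal_mono hKb (hfin b)
  rw [setIntegral_closedBall_of_homogeneous μ hφ ha] at hI1
  rw [setIntegral_closedBall_of_homogeneous μ hφ hb] at hI2
  rw [Measure.addHaar_real_closedBall μ _ ha.le] at hm1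
  rw [Measure.addHaar_real_closedBall μ _ hb.le] at hm2
  have hB : μ.real (closedBall (0 : D) 1) = μ.real (ball (0 : D) 1) := by
    rw [Measure.addHaar_real_closedBall μ _ zero_le_one]; simp
  have hBpos : 0 < μ.real (ball (0 : D) 1) :=
    ENNReal.toReal_pos (measure_ball_pos μ _ one_pos).ne' measure_ball_lt_top.ne
  have hI0 : 0 ≤ ∫ f in closedBall (0 : D) 1, φ f ∂μ := integral_nonneg h0
  simp only [setAverage_eq, smul_eq_mul, hB]
  set m := μ.real (ball (0 : D) 1)
  set I := ∫ f in closedBall (0 : D) 1, φ f ∂μ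
  have hKpos : 0 < μ.real K := lt_of_lt_of_le (by positivity) hm1
  constructor
  · calc a ^ (d + 2) / b ^ d * (m⁻¹ * I) = (b ^ d * m)⁻¹ * (a ^ (d + 2) * I) := by
          field_simp
      _ ≤ _ := by gcongr
  · have hIK : 0 ≤ ∫ f in K, φ f ∂μ := integral_nonneg h0
    calc _ ≤ (a ^ d * m)⁻¹ * (b ^ (d + 2) * I) := by gcongr
      _ = _ := by field_simp

section DualBall

variable (𝕜 : Type*) [RCLike 𝕜] {V W : Type*} [NormedAddCommGroup V] [NormedSpace 𝕜 V]
  [NormedAddCommGroup W] [NormedSpace 𝕜 W]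

instance StrongDual.finiteDimensional_real [FiniteDimensional 𝕜 V] :
    FiniteDimensional ℝ (StrongDual 𝕜 V) :=
  FiniteDimensional.trans ℝ 𝕜 _

instance StrongDual.properSpace [FiniteDimensional 𝕜 V] : ProperSpace (StrongDual 𝕜 V) :=
  FiniteDimensional.proper 𝕜 _

theorem StrongDual.finrank_real [FiniteDimensional 𝕜 V] :
    Module.finrank ℝ (StrongDual 𝕜 V) = Module.finrank ℝ 𝕜 * Module.finrank 𝕜 V := by
  rw [← Module.finrank_mul_finrank ℝ 𝕜 (StrongDual 𝕜 V),
    ← (LinearMap.toContinuousLinearMap (𝕜 := 𝕜) (E := V) (F' := 𝕜)).finrank_eq]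
  congr 1
  exact Subspace.dual_finrank_eq

open MeasureTheory Metric

theorem continuous_dualBall_integrand (v w : V) :
    Continuous fun f : StrongDual 𝕜 V => (starRingEnd 𝕜) (f v) * f w :=
  (RCLike.continuous_conj.comp (ContinuousLinearMap.apply 𝕜 𝕜 v).continuous).mul
    (ContinuousLinearMap.apply 𝕜 𝕜 w).continuous

theorem continuous_norm_apply_sq (v : V) :
    Continuous fun f : StrongDual 𝕜 V => ‖f v‖ ^ 2 :=
  ((ContinuousLinearMap.apply 𝕜 𝕜 v).continuous.norm).pow 2

variable [FiniteDimensional 𝕜 V] [FiniteDimensional 𝕜 W]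

/-- The inner product on a finite-dimensional normed space obtained by averaging
`conj (f v) * f w` over the functionals `f` in the closed unit ball of the dual. -/
noncomputable def dualBallInner (v w : V) : 𝕜 :=
  ⨍ f in closedBall (0 : StrongDual 𝕜 V) 1, (starRingEnd 𝕜) (f v) * f w ∂Measure.addHaar

/-- The average of `‖f v‖ ^ 2` over the functionals `f` in the closed unit ball of the dual. -/
noncomputable def dualBallSq (v : V) : ℝ :=
  ⨍ f in closedBall (0 : StrongDual 𝕜 V) 1, ‖f v‖ ^ 2 ∂Measure.addHaar

theorem dualBallInner_self (v : V) : dualBallInner 𝕜 v v = (dualBallSq 𝕜 v : 𝕜) := by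
  simp only [dualBallInner, dualBallSq, setAverage_eq, RCLike.conj_mul]
  rw [RCLike.real_smul_eq_coe_mul, smul_eq_mul, RCLike.ofReal_mul, ← integral_ofReal]
  simp

theorem dualBallSq_nonneg (v : V) : 0 ≤ dualBallSq 𝕜 v := by
  rw [dualBallSq, setAverage_eq]
  exact smul_nonneg (by positivity) (integral_nonneg fun f => by positivity)

theorem integrableOn_dualBall (v w : V) :
    IntegrableOn (fun f : StrongDual 𝕜 V => (starRingEnd 𝕜) (f v) * f w) (closedBall 0 1)
      Measure.addHaar :=
  (continuous_dualBall_integrand 𝕜 v w).continuousOn.integrableOn_compact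
    (isCompact_closedBall _ _)

theorem dualBallInner_conj_symm (v w : V) :
    (starRingEnd 𝕜) (dualBallInner 𝕜 w v) = dualBallInner 𝕜 v w := by
  simp only [dualBallInner, setAverage_eq, RCLike.real_smul_eq_coe_mul, map_mul,
    RCLike.conj_ofReal, ← integral_conj, RCLike.conj_conj]
  simp only [mul_comm]

theorem dualBallInner_add_left (u v w : V) :
    dualBallInner 𝕜 (u + v) w = dualBallInner 𝕜 u w + dualBallInner 𝕜 v w := by
  simp only [dualBallInner, setAverage_eq, map_add, add_mul]
  rw [integral_add (integrableOn_dualBall 𝕜 u w) (integrableOn_dualBall 𝕜 v w), smul_add]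

theorem dualBallInner_smul_left (v w : V) (c : 𝕜) :
    dualBallInner 𝕜 (c • v) w = (starRingEnd 𝕜) c * dualBallInner 𝕜 v w := by
  simp only [dualBallInner, setAverage_eq, map_smul, smul_eq_mul, map_mul, mul_assoc,
    integral_const_mul, mul_smul_comm]

theorem measureReal_dualBall_pos :
    0 < Measure.addHaar.real (closedBall (0 : StrongDual 𝕜 V) 1) :=
  ENNReal.toReal_pos (measure_closedBall_pos _ _ one_pos).ne' measure_closedBall_lt_top.ne

theorem dualBallSq_le (v : V) : dualBallSq 𝕜 v ≤ ‖v‖ ^ 2 := by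
  have hpos := measureReal_dualBall_pos 𝕜 (V := V)
  rw [dualBallSq, setAverage_eq, smul_eq_mul, inv_mul_le_iff₀ hpos]
  calc ∫ f in closedBall (0 : StrongDual 𝕜 V) 1, ‖f v‖ ^ 2 ∂Measure.addHaar
      ≤ ∫ f in closedBall (0 : StrongDual 𝕜 V) 1, ‖v‖ ^ 2 ∂Measure.addHaar := by
        refine setIntegral_mono_on ?_ ?_ isClosed_closedBall.measurableSet fun f hf => ?_
        · exact (continuous_norm_apply_sq 𝕜 v).continuousOn.integrableOn_compact
            (isCompact_closedBall _ _)
        · exact continuousOn_const.integrableOn_compact (isCompact_closedBall _ _)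
        · have h1 : ‖f‖ ≤ 1 := by simpa using hf
          have := f.le_of_opNorm_le h1 v
          rw [one_mul] at this
          gcongr
    _ = _ := by simp

theorem le_dualBallSq (v : V) :
    (1 / 4) ^ (Module.finrank ℝ 𝕜 * Module.finrank 𝕜 V + 1) * ‖v‖ ^ 2 ≤ dualBallSq 𝕜 v := by
  have hpos := measureReal_dualBall_pos 𝕜 (V := V)
  rw [dualBallSq, setAverage_eq, smul_eq_mul, le_inv_mul_iff₀ hpos, ← StrongDual.finrank_real]
  obtain ⟨g, hg1, hgv⟩ := exists_dual_vector'' 𝕜 v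
  set S : Set (StrongDual 𝕜 V) := closedBall ((3 / 4 : ℝ) • g) (1 / 4)
  have hS : S ⊆ closedBall 0 1 := by
    refine closedBall_subset_closedBall' ?_
    rw [dist_zero_right, norm_smul, Real.norm_of_nonneg (by norm_num)]
    linarith
  have hint : IntegrableOn (fun f : StrongDual 𝕜 V => ‖f v‖ ^ 2) (closedBall 0 1)
      Measure.addHaar :=
    (continuous_norm_apply_sq 𝕜 v).continuousOn.integrableOn_compact (isCompact_closedBall _ _)
  calc Measure.addHaar.real (closedBall (0 : StrongDual 𝕜 V) 1) *
        ((1 / 4) ^ (Module.finrank ℝ (StrongDual 𝕜 V) + 1) * ‖v‖ ^ 2)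
      = ∫ f in S, 1 / 4 * ‖v‖ ^ 2 ∂Measure.addHaar := by
        rw [setIntegral_const, Measure.addHaar_real_closedBall _ _ zero_le_one,
          Measure.addHaar_real_closedBall _ ((3 / 4 : ℝ) • g) (by norm_num), smul_eq_mul]
        ring
    _ ≤ ∫ f in S, ‖f v‖ ^ 2 ∂Measure.addHaar := by
        refine setIntegral_mono_on ?_ (hint.mono_set hS) isClosed_closedBall.measurableSet
          fun f hf => ?_
        · exact continuousOn_const.integrableOn_compact (isCompact_closedBall _ _)
        · have h1 : ‖f - (3 / 4 : ℝ) • g‖ ≤ 1 / 4 := by rwa [← dist_eq_norm]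
          have h2 := (f - (3 / 4 : ℝ) • g).le_of_opNorm_le h1 v
          have h3 : ‖((3 / 4 : ℝ) • g) v‖ = 3 / 4 * ‖v‖ := by
            rw [smul_apply, hgv, norm_smul]
            simp
          have h4 : ‖((3 / 4 : ℝ) • g) v‖ - ‖f v‖ ≤ ‖(f - (3 / 4 : ℝ) • g) v‖ := by
            rw [sub_apply, norm_sub_rev]
            exact norm_sub_norm_le _ _
          have h5 : 1 / 2 * ‖v‖ ≤ ‖f v‖ := by linarith
          calc 1 / 4 * ‖v‖ ^ 2 = (1 / 2 * ‖v‖) ^ 2 := by ring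
            _ ≤ _ := by gcongr
    _ ≤ _ := setIntegral_mono_set hint (Eventually.of_forall fun f => by positivity)
        (LE.le.eventuallyLE hS)

/-- Distortion of `dualBallSq` under a linear isomorphism that distorts the norm by factors
between `a` and `b`. -/
theorem dualBallSq_apply_mem_Icc (L : V ≃ₗ[𝕜] W) {a b : ℝ} (ha : 0 < a) (hb : 0 < b)
    (haL : ∀ v, a * ‖v‖ ≤ ‖L v‖) (hLb : ∀ v, ‖L v‖ ≤ b * ‖v‖) (v : V) :
    dualBallSq 𝕜 (L v) ∈ Set.Icc
      (a ^ (Module.finrank ℝ (StrongDual 𝕜 V) + 2) / b ^ Module.finrank ℝ (StrongDual 𝕜 V) *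
        dualBallSq 𝕜 v)
      (b ^ (Module.finrank ℝ (StrongDual 𝕜 V) + 2) / a ^ Module.finrank ℝ (StrongDual 𝕜 V) *
        dualBallSq 𝕜 v) := by
  let Φ : StrongDual 𝕜 W ≃L[𝕜] StrongDual 𝕜 V :=
    ContinuousLinearEquiv.arrowCongr L.toContinuousLinearEquiv.symm (.refl 𝕜 𝕜)
  have hΦ : ∀ f u, Φ f u = f (L u) := fun f u => rfl
  have hemb : MeasurableEmbedding Φ := Φ.toHomeomorph.measurableEmbedding
  let ν : Measure (StrongDual 𝕜 V) := Measure.addHaar.map Φ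
  have hν : ν.IsAddHaarMeasure := Φ.isAddHaarMeasure_map _
  set K : Set (StrongDual 𝕜 V) := Φ '' closedBall 0 1
  have hpre : Φ ⁻¹' K = closedBall 0 1 := Set.preimage_image_eq _ Φ.injective
  have hW : dualBallSq 𝕜 (L v) = ⨍ f in K, ‖f v‖ ^ 2 ∂ν := by
    rw [dualBallSq, setAverage_eq, setAverage_eq, hemb.setIntegral_map, hpre, measureReal_def,
      measureReal_def, hemb.map_apply, hpre]
    rfl
  have hV : dualBallSq 𝕜 v = ⨍ f in closedBall (0 : StrongDual 𝕜 V) 1, ‖f v‖ ^ 2 ∂ν := by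
    set c := ν.addHaarScalarFactor Measure.addHaar with hc
    have hνc : ν = c • Measure.addHaar := Measure.isAddLeftInvariant_eq_smul ν _
    have hc0 : (c : ℝ) ≠ 0 := by
      have := Measure.addHaarScalarFactor_pos_of_isAddHaarMeasure ν
        (Measure.addHaar : Measure (StrongDual 𝕜 V))
      exact_mod_cast this.ne'
    rw [dualBallSq, hνc, setAverage_eq, setAverage_eq, Measure.restrict_smul,
      integral_smul_nnreal_measure, measureReal_nnreal_smul_apply]
    simp only [smul_eq_mul, NNReal.smul_def]
    field_simp
  rw [hW, hV]
  refine setAverage_mem_Icc_of_between_closedBalls ν (fun r f => ?_)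
    (continuous_norm_apply_sq 𝕜 v) (fun f => by positivity) ha hb ?_ ?_
  · rw [smul_apply, norm_smul, mul_pow, Real.norm_eq_abs, sq_abs]
  · intro f hf
    refine ⟨Φ.symm f, ?_, Φ.apply_symm_apply f⟩
    have hf' : ‖f‖ ≤ a := by simpa using hf
    rw [mem_closedBall_zero_iff]
    refine ContinuousLinearMap.opNorm_le_bound _ zero_le_one fun w => ?_
    obtain ⟨u, rfl⟩ := L.surjective w
    rw [← hΦ, Φ.apply_symm_apply, one_mul]
    exact (f.le_of_opNorm_le hf' u).trans (haL u)
  · rintro _ ⟨g, hg, rfl⟩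
    have hg' : ‖g‖ ≤ 1 := by simpa using hg
    rw [mem_closedBall_zero_iff]
    refine ContinuousLinearMap.opNorm_le_bound _ hb.le fun u => ?_
    rw [hΦ]
    have := g.le_of_opNorm_le hg' (L u)
    rw [one_mul] at this
    exact this.trans (hLb u)

/-- The inner product `dualBallInner` as a core. -/
@[reducible] noncomputable def dualBallCore : InnerProductSpace.Core 𝕜 V where
  inner v w := dualBallInner 𝕜 v w
  conj_inner_symm v w := dualBallInner_conj_symm 𝕜 v w
  re_inner_nonneg v := by
    rw [dualBallInner_self, RCLike.ofReal_re]
    exact dualBallSq_nonneg 𝕜 v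
  add_left u v w := dualBallInner_add_left 𝕜 u v w
  smul_left v w c := dualBallInner_smul_left 𝕜 v w c
  definite v hv := by
    rw [dualBallInner_self, RCLike.ofReal_eq_zero] at hv
    have h := le_dualBallSq 𝕜 v
    rw [hv] at h
    have h2 : ‖v‖ ^ 2 ≤ 0 := nonpos_of_mul_nonpos_right h (by positivity)
    exact norm_eq_zero.1 (pow_eq_zero_iff two_ne_zero |>.1 (h2.antisymm (by positivity)))

/-- A copy of a finite-dimensional normed space, with the Hilbert norm given by
`dualBallInner`. -/
def DualBallHilbert (_𝕜 : Type*) (V : Type*) : Type _ := V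

namespace DualBallHilbert

instance : AddCommGroup (DualBallHilbert 𝕜 V) := inferInstanceAs (AddCommGroup V)

instance : Module 𝕜 (DualBallHilbert 𝕜 V) := inferInstanceAs (Module 𝕜 V)

instance : FiniteDimensional 𝕜 (DualBallHilbert 𝕜 V) :=
  inferInstanceAs (FiniteDimensional 𝕜 V)

/-- The inner product `dualBallInner` as a core on the copy. -/
@[reducible] noncomputable def core : InnerProductSpace.Core 𝕜 (DualBallHilbert 𝕜 V) :=
  (dualBallCore 𝕜 : InnerProductSpace.Core 𝕜 V)

noncomputable instance : NormedAddCommGroup (DualBallHilbert 𝕜 V) :=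
  (core 𝕜 (V := V)).toNormedAddCommGroup

noncomputable instance : InnerProductSpace 𝕜 (DualBallHilbert 𝕜 V) :=
  InnerProductSpace.ofCore (core 𝕜 (V := V)).toCore

/-- The identity map. -/
def equiv : V ≃ₗ[𝕜] DualBallHilbert 𝕜 V := LinearEquiv.refl 𝕜 V

theorem norm_sq (v : V) : ‖equiv 𝕜 v‖ ^ 2 = dualBallSq 𝕜 v := by
  rw [← inner_self_eq_norm_sq (𝕜 := 𝕜)]
  change RCLike.re (dualBallInner 𝕜 v v) = _
  rw [dualBallInner_self, RCLike.ofReal_re]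

theorem norm_equiv_le (v : V) : ‖equiv 𝕜 v‖ ≤ ‖v‖ :=
  le_of_sq_le_sq (by rw [norm_sq]; exact dualBallSq_le 𝕜 v) (norm_nonneg _)

theorem le_norm_equiv (v : V) :
    (1 / 2) ^ (Module.finrank ℝ 𝕜 * Module.finrank 𝕜 V + 1) * ‖v‖ ≤ ‖equiv 𝕜 v‖ := by
  refine le_of_sq_le_sq ?_ (norm_nonneg _)
  rw [norm_sq, mul_pow, ← pow_mul, mul_comm _ 2, pow_mul]
  refine le_trans (le_of_eq ?_) (le_dualBallSq 𝕜 v)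
  norm_num

end DualBallHilbert

end DualBall

namespace IsFellBundle

section Limits

variable (𝕜 : Type*) [RCLike 𝕜] {X : Type*} [TopologicalSpace X] {E : X → Type*}
  [∀ x, NormedAddCommGroup (E x)] [∀ x, NormedSpace 𝕜 (E x)]
  [TopologicalSpace (BundleTotal E)] [IsFellBundle 𝕜 E]
  {ι : Type*} {l : Filter ι} {x : ι → X} {x₀ : X} {s t : ∀ i, E (x i)} {s₀ t₀ : E x₀}

include 𝕜

theorem tendsto_zero (hx : Tendsto x l (𝓝 x₀)) (hs : Tendsto (fun i => ‖s i‖) l (𝓝 0)) :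
    Tendsto (fun i => (⟨x i, s i⟩ : BundleTotal E)) l (𝓝 ⟨x₀, 0⟩) := by
  refine ((hasBasis_nhds_zero (𝕜 := 𝕜) (E := E) x₀).tendsto_right_iff).2 ?_
  rintro ⟨U, ε⟩ ⟨hU, hε⟩
  filter_upwards [hx hU, hs.eventually_lt_const hε] with i h1 h2
  exact ⟨h1, h2⟩

theorem tendsto_norm (hs : Tendsto (fun i => (⟨x i, s i⟩ : BundleTotal E)) l (𝓝 ⟨x₀, s₀⟩)) :
    Tendsto (fun i => ‖s i‖) l (𝓝 ‖s₀‖) :=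
  ((continuous_norm (𝕜 := 𝕜) (E := E)).tendsto _).comp hs

theorem tendsto_proj (hs : Tendsto (fun i => (⟨x i, s i⟩ : BundleTotal E)) l (𝓝 ⟨x₀, s₀⟩)) :
    Tendsto x l (𝓝 x₀) :=
  ((continuous_proj (𝕜 := 𝕜) (E := E)).tendsto _).comp hs

theorem tendsto_add (hs : Tendsto (fun i => (⟨x i, s i⟩ : BundleTotal E)) l (𝓝 ⟨x₀, s₀⟩))
    (ht : Tendsto (fun i => (⟨x i, t i⟩ : BundleTotal E)) l (𝓝 ⟨x₀, t₀⟩)) :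
    Tendsto (fun i => (⟨x i, s i + t i⟩ : BundleTotal E)) l (𝓝 ⟨x₀, s₀ + t₀⟩) := by
  have h : Tendsto
      (fun i => (⟨x i, (s i, t i)⟩ : Bundle.TotalSpace (Unit × Unit) (E ×ᵇ E))) l
      (𝓝 ⟨x₀, (s₀, t₀)⟩) :=
    (FiberBundle.Prod.isInducing_diag Unit E Unit E).tendsto_nhds_iff.2 (hs.prodMk_nhds ht)
  exact ((continuous_add (𝕜 := 𝕜) (E := E)).tendsto _).comp h

variable {𝕜} in
theorem tendsto_smul {c : ι → 𝕜} {c₀ : 𝕜} (hc : Tendsto c l (𝓝 c₀))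
    (hs : Tendsto (fun i => (⟨x i, s i⟩ : BundleTotal E)) l (𝓝 ⟨x₀, s₀⟩)) :
    Tendsto (fun i => (⟨x i, c i • s i⟩ : BundleTotal E)) l (𝓝 ⟨x₀, c₀ • s₀⟩) :=
  ((continuous_smul (𝕜 := 𝕜) (E := E)).tendsto (c₀, ⟨x₀, s₀⟩)).comp (hc.prodMk_nhds hs)

theorem tendsto_sub (hs : Tendsto (fun i => (⟨x i, s i⟩ : BundleTotal E)) l (𝓝 ⟨x₀, s₀⟩))
    (ht : Tendsto (fun i => (⟨x i, t i⟩ : BundleTotal E)) l (𝓝 ⟨x₀, t₀⟩)) :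
    Tendsto (fun i => (⟨x i, s i - t i⟩ : BundleTotal E)) l (𝓝 ⟨x₀, s₀ - t₀⟩) := by
  have h := tendsto_add 𝕜 hs (tendsto_smul (tendsto_const_nhds (x := (-1 : 𝕜))) ht)
  simpa only [neg_smul, one_smul, ← sub_eq_add_neg] using h

theorem tendsto_sum {κ : Type*} (S : Finset κ) {s : ∀ i, κ → E (x i)} {s₀ : κ → E x₀}
    (hx : Tendsto x l (𝓝 x₀))
    (hs : ∀ k ∈ S, Tendsto (fun i => (⟨x i, s i k⟩ : BundleTotal E)) l (𝓝 ⟨x₀, s₀ k⟩)) :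
    Tendsto (fun i => (⟨x i, ∑ k ∈ S, s i k⟩ : BundleTotal E)) l
      (𝓝 ⟨x₀, ∑ k ∈ S, s₀ k⟩) := by
  classical
  induction S using Finset.induction_on with
  | empty =>
    simp only [Finset.sum_empty]
    exact tendsto_zero 𝕜 hx (by simpa using tendsto_const_nhds)
  | insert a S ha ih =>
    simp only [Finset.sum_insert ha]
    exact tendsto_add 𝕜 (hs a (Finset.mem_insert_self a S))
      (ih fun k hk => hs k (Finset.mem_insert_of_mem hk))

/-- Openness of the projection: one can always lift along a given point of a fiber. -/
theorem exists_lift {V : Set (BundleTotal E)} (hV : V ∈ 𝓝 (⟨x₀, s₀⟩ : BundleTotal E)) :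
    ∀ᶠ y in 𝓝 x₀, ∃ v : E y, (⟨y, v⟩ : BundleTotal E) ∈ V := by
  filter_upwards [(isOpenMap_proj (𝕜 := 𝕜) (E := E)).image_mem_nhds hV]
  rintro _ ⟨q, hq, rfl⟩
  exact ⟨q.snd, hq⟩

end Limits

section Frames

variable (𝕜 : Type*) [RCLike 𝕜] {X : Type*} [TopologicalSpace X] {E : X → Type*}
  [∀ x, NormedAddCommGroup (E x)] [∀ x, NormedSpace 𝕜 (E x)]
  [TopologicalSpace (BundleTotal E)] [IsFellBundle 𝕜 E] [∀ x, FiniteDimensional 𝕜 (E x)]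
  {ι κ : Type*} [Fintype κ] {l : Filter ι} {x : ι → X} {x₀ : X} (b : Module.Basis κ 𝕜 (E x₀))
  {e : ∀ j, κ → E (x j)}

theorem tendsto_constr (hx : Tendsto x l (𝓝 x₀))
    (he : ∀ k, Tendsto (fun j => (⟨x j, e j k⟩ : BundleTotal E)) l (𝓝 ⟨x₀, b k⟩))
    (v : E x₀) :
    Tendsto (fun q : ι × E x₀ => (⟨x q.1, b.constr 𝕜 (e q.1) q.2⟩ : BundleTotal E))
      (l ×ˢ 𝓝 v) (𝓝 ⟨x₀, v⟩) := by
  have hc : Continuous b.equivFun :=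
    LinearMap.continuous_of_finiteDimensional b.equivFun.toLinearMap
  simp only [Module.Basis.constr_apply_fintype]
  have h := tendsto_sum 𝕜 (l := l ×ˢ 𝓝 v) (x := fun q => x q.1)
    (s := fun q k => b.equivFun q.2 k • e q.1 k) (s₀ := fun k => b.equivFun v k • b k)
    Finset.univ (hx.comp tendsto_fst) fun k _ => ?_
  · rwa [b.sum_equivFun] at h
  · refine tendsto_smul ?_ ((he k).comp tendsto_fst)
    exact (((continuous_apply k).comp hc).tendsto v).comp tendsto_snd

/-- The linear map that moves a basis of a fiber to nearby vectors of a nearby fiber is nearly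
isometric. -/
theorem eventually_constr_almost_isometry (hx : Tendsto x l (𝓝 x₀))
    (he : ∀ k, Tendsto (fun j => (⟨x j, e j k⟩ : BundleTotal E)) l (𝓝 ⟨x₀, b k⟩))
    {δ : ℝ} (hδ : 0 < δ) :
    ∀ᶠ j in l, ∀ v : E x₀,
      (1 - δ) * ‖v‖ ≤ ‖b.constr 𝕜 (e j) v‖ ∧ ‖b.constr 𝕜 (e j) v‖ ≤ (1 + δ) * ‖v‖ := by
  have : ProperSpace (E x₀) := FiniteDimensional.proper 𝕜 _
  have hmem : {q : ι × E x₀ | |‖b.constr 𝕜 (e q.1) q.2‖ - ‖q.2‖| < δ} ∈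
      l ×ˢ 𝓝ˢ (Metric.sphere (0 : E x₀) 1) := by
    refine (isCompact_sphere _ _).mem_prod_nhdsSet_of_forall fun v _ => ?_
    have h1 := tendsto_norm 𝕜 (tendsto_constr 𝕜 b hx he v)
    have h2 : Tendsto (fun q : ι × E x₀ => ‖q.2‖) (l ×ˢ 𝓝 v) (𝓝 ‖v‖) :=
      (continuous_id.norm.tendsto v).comp tendsto_snd
    have h3 := (h1.sub h2).abs
    rw [sub_self, abs_zero] at h3
    exact h3.eventually_lt_const hδ
  obtain ⟨P, hP, Q, hQ, hPQ⟩ := eventually_prod_iff.1 hmem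
  filter_upwards [hP] with j hj v
  rcases eq_or_ne v 0 with rfl | hv
  · simp
  have hv' : ‖v‖ ≠ 0 := norm_ne_zero_iff.2 hv
  set u : E x₀ := ((‖v‖ : 𝕜))⁻¹ • v with hu
  have hu1 : ‖u‖ = 1 := by
    rw [hu, norm_smul, norm_inv, RCLike.norm_ofReal, abs_norm, inv_mul_cancel₀ hv']
  have hvu : v = (‖v‖ : 𝕜) • u := by
    rw [hu, smul_inv_smul₀]
    exact_mod_cast hv'
  have hlt : |‖b.constr 𝕜 (e j) u‖ - ‖u‖| < δ :=
    hPQ hj (hQ.self_of_nhdsSet u (mem_sphere_zero_iff_norm.2 hu1))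
  rw [hu1, abs_lt] at hlt
  have hLv : ‖b.constr 𝕜 (e j) v‖ = ‖v‖ * ‖b.constr 𝕜 (e j) u‖ := by
    conv_lhs => rw [hvu, map_smul, norm_smul, RCLike.norm_ofReal, abs_norm]
  have hvpos : 0 < ‖v‖ := norm_pos_iff.2 hv
  rw [hLv]
  constructor <;> nlinarith

theorem tendsto_dualBallSq_constr (hdim : ∀ y, Module.finrank 𝕜 (E y) = Module.finrank 𝕜 (E x₀))
    (hx : Tendsto x l (𝓝 x₀))
    (he : ∀ k, Tendsto (fun j => (⟨x j, e j k⟩ : BundleTotal E)) l (𝓝 ⟨x₀, b k⟩))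
    (v : E x₀) :
    Tendsto (fun j => dualBallSq 𝕜 (b.constr 𝕜 (e j) v)) l (𝓝 (dualBallSq 𝕜 v)) := by
  set d := Module.finrank ℝ (StrongDual 𝕜 (E x₀))
  set H := dualBallSq 𝕜 v
  have hlow : Tendsto (fun δ : ℝ => (1 - δ) ^ (d + 2) / (1 + δ) ^ d * H) (𝓝[>] 0) (𝓝 H) := by
    have h : ContinuousAt (fun δ : ℝ => (1 - δ) ^ (d + 2) / (1 + δ) ^ d * H) 0 := by
      refine ContinuousAt.mul (ContinuousAt.div (by fun_prop) (by fun_prop) ?_) (by fun_prop)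
      simp
    simpa [ContinuousAt] using h.tendsto.mono_left nhdsWithin_le_nhds
  have hupp : Tendsto (fun δ : ℝ => (1 + δ) ^ (d + 2) / (1 - δ) ^ d * H) (𝓝[>] 0) (𝓝 H) := by
    have h : ContinuousAt (fun δ : ℝ => (1 + δ) ^ (d + 2) / (1 - δ) ^ d * H) 0 := by
      refine ContinuousAt.mul (ContinuousAt.div (by fun_prop) (by fun_prop) ?_) (by fun_prop)
      simp
    simpa [ContinuousAt] using h.tendsto.mono_left nhdsWithin_le_nhds
  have hone : ∀ᶠ δ : ℝ in 𝓝[>] 0, δ < 1 := nhdsWithin_le_nhds (Iio_mem_nhds one_pos)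
  have key : ∀ δ : ℝ, 0 < δ → δ < 1 → ∀ᶠ j in l,
      (1 - δ) ^ (d + 2) / (1 + δ) ^ d * H ≤ dualBallSq 𝕜 (b.constr 𝕜 (e j) v) ∧
      dualBallSq 𝕜 (b.constr 𝕜 (e j) v) ≤ (1 + δ) ^ (d + 2) / (1 - δ) ^ d * H := by
    intro δ h0 h1
    filter_upwards [eventually_constr_almost_isometry 𝕜 b hx he h0] with j hj
    have hinj : Function.Injective (b.constr 𝕜 (e j)) := by
      rw [injective_iff_map_eq_zero]
      intro w hw
      have := (hj w).1
      rw [hw, norm_zero] at this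
      exact norm_le_zero_iff.1 (nonpos_of_mul_nonpos_right this (by linarith))
    exact dualBallSq_apply_mem_Icc 𝕜
      ((b.constr 𝕜 (e j)).linearEquivOfInjective hinj (hdim (x j)).symm)
      (by linarith) (by linarith) (fun w => (hj w).1) (fun w => (hj w).2) v
  refine tendsto_order.2 ⟨fun a ha => ?_, fun a ha => ?_⟩
  · obtain ⟨δ, hδa, hδ1, hδ0⟩ := ((hlow.eventually_const_lt ha).and
      (hone.and self_mem_nhdsWithin)).exists
    filter_upwards [key δ hδ0 hδ1] with j hj
    exact hδa.trans_le hj.1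
  · obtain ⟨δ, hδa, hδ1, hδ0⟩ := ((hupp.eventually_lt_const ha).and
      (hone.and self_mem_nhdsWithin)).exists
    filter_upwards [key δ hδ0 hδ1] with j hj
    exact hj.2.trans_lt hδa

theorem tendsto_norm_dualBallHilbert
    (hdim : ∀ y, Module.finrank 𝕜 (E y) = Module.finrank 𝕜 (E x₀))
    (he : ∀ k, Tendsto (fun j => (⟨x j, e j k⟩ : BundleTotal E)) l (𝓝 ⟨x₀, b k⟩))
    {s : ∀ j, E (x j)} {s₀ : E x₀}
    (hs : Tendsto (fun j => (⟨x j, s j⟩ : BundleTotal E)) l (𝓝 ⟨x₀, s₀⟩)) :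
    Tendsto (fun j => ‖DualBallHilbert.equiv 𝕜 (s j)‖) l
      (𝓝 ‖DualBallHilbert.equiv 𝕜 s₀‖) := by
  have hx := tendsto_proj 𝕜 hs
  have hsqrt : ∀ {y : X} (v : E y),
      ‖DualBallHilbert.equiv 𝕜 v‖ = Real.sqrt (dualBallSq 𝕜 v) := fun v => by
    rw [← DualBallHilbert.norm_sq, Real.sqrt_sq (norm_nonneg _)]
  have h1 : Tendsto (fun j => ‖DualBallHilbert.equiv 𝕜 (b.constr 𝕜 (e j) s₀)‖) l
      (𝓝 ‖DualBallHilbert.equiv 𝕜 s₀‖) := by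
    simp only [hsqrt]
    exact (tendsto_dualBallSq_constr 𝕜 b hdim hx he s₀).sqrt
  have h2 : Tendsto (fun j => (⟨x j, b.constr 𝕜 (e j) s₀⟩ : BundleTotal E)) l (𝓝 ⟨x₀, s₀⟩) :=
    (tendsto_constr 𝕜 b hx he s₀).comp (tendsto_id.prodMk tendsto_const_nhds)
  have h3 := tendsto_norm 𝕜 (tendsto_sub 𝕜 hs h2)
  rw [sub_self, norm_zero] at h3
  have h4 : Tendsto (fun j => ‖DualBallHilbert.equiv 𝕜 (s j)‖ -
      ‖DualBallHilbert.equiv 𝕜 (b.constr 𝕜 (e j) s₀)‖) l (𝓝 0) := by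
    refine squeeze_zero_norm (fun j => ?_) h3
    refine (abs_norm_sub_norm_le _ _).trans ?_
    rw [← map_sub]
    exact DualBallHilbert.norm_equiv_le 𝕜 _
  simpa using h4.add h1

/-- The Hilbert norm given by averaging over the dual unit balls is continuous on the total
space. -/
theorem continuous_norm_dualBallHilbert (n : ℕ) (hdim : ∀ y, Module.finrank 𝕜 (E y) = n) :
    Continuous fun p : BundleTotal E => ‖DualBallHilbert.equiv 𝕜 p.snd‖ := by
  refine continuous_iff_continuousAt.2 fun p₀ => ?_
  obtain ⟨x₀, s₀⟩ := p₀
  let b := Module.finBasis 𝕜 (E x₀)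
  let κ := Fin (Module.finrank 𝕜 (E x₀))
  let F : (Σ y, E y × (κ → E y)) → BundleTotal E × (κ → BundleTotal E) :=
    fun z => (⟨z.1, z.2.1⟩, fun k => ⟨z.1, z.2.2 k⟩)
  let l := comap F (𝓝 (⟨x₀, s₀⟩, fun k => ⟨x₀, b k⟩))
  have hF : Tendsto F l (𝓝 (⟨x₀, s₀⟩, fun k => ⟨x₀, b k⟩)) := tendsto_comap
  have hs : Tendsto (fun z : Σ y, E y × (κ → E y) => (⟨z.1, z.2.1⟩ : BundleTotal E)) l
      (𝓝 ⟨x₀, s₀⟩) := (continuous_fst.tendsto _).comp hF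
  have he : ∀ k, Tendsto (fun z : Σ y, E y × (κ → E y) => (⟨z.1, z.2.2 k⟩ : BundleTotal E)) l
      (𝓝 ⟨x₀, b k⟩) := fun k =>
    (((continuous_apply k).comp continuous_snd).tendsto
      ((⟨x₀, s₀⟩, fun k => ⟨x₀, b k⟩) : BundleTotal E × (κ → BundleTotal E))).comp hF
  have hlim := tendsto_norm_dualBallHilbert 𝕜 b (fun y => (hdim y).trans (hdim x₀).symm) he hs
  have hle : 𝓝 (⟨x₀, s₀⟩ : BundleTotal E) ≤
      map (fun z : Σ y, E y × (κ → E y) => (⟨z.1, z.2.1⟩ : BundleTotal E)) l := by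
    refine le_map fun A hA => ?_
    obtain ⟨B, hB, hBA⟩ := mem_comap.1 hA
    rw [nhds_prod_eq, nhds_pi] at hB
    obtain ⟨V, hV, W, hW, hVW⟩ := eventually_prod_iff.1 hB
    obtain ⟨I, -, t, ht, htW⟩ := Filter.mem_pi.1 hW
    have hlift : ∀ᶠ q : BundleTotal E in 𝓝 ⟨x₀, s₀⟩,
        ∀ k, ∃ v : E q.proj, (⟨q.proj, v⟩ : BundleTotal E) ∈ t k :=
      (((continuous_proj (𝕜 := 𝕜) (E := E)).tendsto ⟨x₀, s₀⟩).eventually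
        (eventually_all.2 fun k => exists_lift 𝕜 (ht k)))
    filter_upwards [hV, hlift] with q hqV hq
    choose w hw using hq
    have hw' : W fun k => ⟨q.proj, w k⟩ :=
      Set.mem_of_subset_of_mem htW (Set.mem_pi.2 fun k _ => hw k)
    have hmem : (⟨q.proj, q.snd, w⟩ : Σ y, E y × (κ → E y)) ∈ F ⁻¹' B :=
      Set.mem_preimage.2 (hVW hqV hw')
    exact ⟨⟨q.proj, q.snd, w⟩, Set.mem_of_subset_of_mem hBA hmem, rfl⟩
  have hmap : Tendsto (fun p : BundleTotal E => ‖DualBallHilbert.equiv 𝕜 p.snd‖)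
      (map (fun z : Σ y, E y × (κ → E y) => (⟨z.1, z.2.1⟩ : BundleTotal E)) l)
      (𝓝 ‖DualBallHilbert.equiv 𝕜 s₀‖) := tendsto_map' hlim
  exact hmap.mono_left hle

end Frames

end IsFellBundle

section Renorming

variable {𝕜 : Type*} [RCLike 𝕜] {X : Type*} {E F : X → Type*}
  [∀ x, NormedAddCommGroup (E x)] [∀ x, NormedSpace 𝕜 (E x)]
  [∀ x, NormedAddCommGroup (F x)] [∀ x, NormedSpace 𝕜 (F x)]

/-- The bijection of total spaces given by a family of linear isomorphisms of fibers. -/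
def BundleTotal.equivOfFiberwise (e : ∀ x, E x ≃ₗ[𝕜] F x) : BundleTotal E ≃ BundleTotal F where
  toFun p := ⟨p.proj, e p.proj p.snd⟩
  invFun p := ⟨p.proj, (e p.proj).symm p.snd⟩
  left_inv p := by simp
  right_inv p := by simp

variable [TopologicalSpace X] [TopologicalSpace (BundleTotal E)] [IsFellBundle 𝕜 E]

/-- A bundle obtained by changing the norm of an (F) Banach bundle to a uniformly equivalent norm
that is continuous on the total space is again an (F) Banach bundle. -/
theorem IsFellBundle.of_equiv [TopologicalSpace (BundleTotal F)] (e : ∀ x, E x ≃ₗ[𝕜] F x)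
    (he : IsHomeomorph (BundleTotal.equivOfFiberwise e)) {c C : ℝ} (hc : 0 < c) (hC : 0 < C)
    (hcF : ∀ x v, c * ‖v‖ ≤ ‖e x v‖) (hFC : ∀ x v, ‖e x v‖ ≤ C * ‖v‖)
    (hcomplete : ∀ x, CompleteSpace (F x))
    (hnorm : Continuous fun p : BundleTotal E => ‖e p.proj p.snd‖) : IsFellBundle 𝕜 F := by
  let Φ : BundleTotal E ≃ₜ BundleTotal F := he.homeomorph
  have hΦ : ∀ p, Φ p = ⟨p.proj, e p.proj p.snd⟩ := fun p => rfl
  have hΦs : ∀ q : BundleTotal F, Φ.symm q = ⟨q.proj, (e q.proj).symm q.snd⟩ := fun q => by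
    rw [Φ.symm_apply_eq, hΦ]
    simp
  refine ⟨hcomplete, ?_, ?_, ?_, ?_, ?_, ?_⟩
  · have h := (IsFellBundle.continuous_proj (𝕜 := 𝕜) (E := E)).comp Φ.symm.continuous
    refine h.congr fun q => ?_
    simp [hΦs]
  · have h := (IsFellBundle.isOpenMap_proj (𝕜 := 𝕜) (E := E)).comp Φ.symm.isOpenMap
    have h2 : (fun p : BundleTotal E => p.proj) ∘ Φ.symm = fun q : BundleTotal F => q.proj := by
      funext q
      simp [hΦs]
    rwa [h2] at h
  · have h := Φ.continuous.comp ((IsFellBundle.continuous_smul (𝕜 := 𝕜) (E := E)).comp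
      (continuous_id.prodMap Φ.symm.continuous))
    refine h.congr fun q => ?_
    change Φ ⟨(Φ.symm q.2).proj, q.1 • (Φ.symm q.2).snd⟩ = _
    rw [hΦs, hΦ]
    simp
  · have h1 : Continuous fun q : Bundle.TotalSpace (Unit × Unit) (F ×ᵇ F) =>
        (⟨q.proj, ((e q.proj).symm q.snd.1, (e q.proj).symm q.snd.2)⟩ :
          Bundle.TotalSpace (Unit × Unit) (E ×ᵇ E)) := by
      refine (FiberBundle.Prod.isInducing_diag Unit E Unit E).continuous_iff.2 ?_
      have h2 := (Φ.symm.continuous.prodMap Φ.symm.continuous).comp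
        (FiberBundle.Prod.isInducing_diag Unit F Unit F).continuous
      refine h2.congr fun q => ?_
      simp [hΦs]
    refine (Φ.continuous.comp ((IsFellBundle.continuous_add (𝕜 := 𝕜) (E := E)).comp h1)).congr
      fun q => ?_
    simp [hΦ]
  · refine (hnorm.comp Φ.symm.continuous).congr fun q => ?_
    change ‖e (Φ.symm q).proj (Φ.symm q).snd‖ = _
    rw [hΦs]
    simp
  · intro x
    have h := (IsFellBundle.hasBasis_nhds_zero (𝕜 := 𝕜) (E := E) x).map Φ
    have h0 : Φ ⟨x, 0⟩ = ⟨x, 0⟩ := by simp [hΦ]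
    rw [Φ.map_nhds_eq, h0] at h
    refine h.to_hasBasis ?_ ?_
    · rintro ⟨U, ε⟩ ⟨hU, hε⟩
      refine ⟨(U, c * ε), ⟨hU, by positivity⟩, ?_⟩
      rintro q ⟨hqU, hq⟩
      refine ⟨Φ.symm q, ?_, Φ.apply_symm_apply q⟩
      rw [hΦs]
      refine ⟨hqU, ?_⟩
      have := hcF q.proj ((e q.proj).symm q.snd)
      rw [LinearEquiv.apply_symm_apply] at this
      exact lt_of_mul_lt_mul_left (this.trans_lt hq) hc.le
    · rintro ⟨U, ε⟩ ⟨hU, hε⟩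
      refine ⟨(U, ε / C), ⟨hU, by positivity⟩, ?_⟩
      rintro _ ⟨p, ⟨hpU, hp⟩, rfl⟩
      rw [hΦ]
      refine ⟨hpU, (hFC _ _).trans_lt ?_⟩
      rw [mul_comm]
      exact (lt_div_iff₀ hC).1 hp

end Renorming

section DualBallRenorming

universe u v

variable (𝕜 : Type*) [RCLike 𝕜] {X : Type u} [TopologicalSpace X] (E : X → Type v)
  [∀ x, NormedAddCommGroup (E x)] [∀ x, NormedSpace 𝕜 (E x)]
  [TopologicalSpace (BundleTotal E)] [IsFellBundle 𝕜 E]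

/-- A homogeneous bundle has a Hilbert-bundle renorming with uniformly equivalent norms. -/
theorem exists_hilbertRenorming_bounds {n : ℕ} (hE : IsHomogeneousBundle 𝕜 E n) :
    ∃ (R : HilbertRenorming.{_, u, v, v} 𝕜 E) (c : ℝ), 0 < c ∧
      (∀ x v, c * ‖v‖ ≤ ‖R.equiv x v‖) ∧ ∀ x v, ‖R.equiv x v‖ ≤ ‖v‖ := by
  have hfin : ∀ x, FiniteDimensional 𝕜 (E x) := fun x => (hE x).1
  let F : X → Type v := fun x => DualBallHilbert 𝕜 (E x)
  let e : ∀ x, E x ≃ₗ[𝕜] F x := fun x => DualBallHilbert.equiv 𝕜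
  let Φ := BundleTotal.equivOfFiberwise e
  let τ : TopologicalSpace (BundleTotal F) := TopologicalSpace.induced Φ.symm inferInstance
  have hΦ : IsHomeomorph Φ := (Φ.symm.toHomeomorphOfIsInducing ⟨rfl⟩).symm.isHomeomorph
  set c : ℝ := (1 / 2) ^ (Module.finrank ℝ 𝕜 * n + 1)
  have hc : 0 < c := by positivity
  have hcF : ∀ x v, c * ‖v‖ ≤ ‖e x v‖ := fun x v => by
    have h := DualBallHilbert.le_norm_equiv 𝕜 v
    rwa [(hE x).2] at h
  have hFC : ∀ x v, ‖e x v‖ ≤ ‖v‖ := fun x v => DualBallHilbert.norm_equiv_le 𝕜 v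
  have hFell : IsFellBundle 𝕜 F :=
    IsFellBundle.of_equiv e hΦ hc one_pos hcF (fun x v => by simpa using hFC x v)
      (fun x => FiniteDimensional.complete 𝕜 (DualBallHilbert 𝕜 (E x)))
      (IsFellBundle.continuous_norm_dualBallHilbert 𝕜 n fun x => (hE x).2)
  exact ⟨{ Fiber := F, topTotal := τ, isFell := hFell, equiv := e, isHomeomorph_equiv := hΦ },
    c, hc, hcF, hFC⟩

end DualBallRenorming

section SectionSpaces

variable {𝕜 : Type*} [RCLike 𝕜] {X : Type*} {E F : X → Type*}
  [∀ x, NormedAddCommGroup (E x)] [∀ x, NormedSpace 𝕜 (E x)]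
  [∀ x, NormedAddCommGroup (F x)] [∀ x, NormedSpace 𝕜 (F x)]

theorem memℓp_infty_of_norm_le {s : ∀ x, F x} (t : lp E ∞) {C : ℝ} (hC : 0 ≤ C)
    (h : ∀ x, ‖s x‖ ≤ C * ‖t x‖) : Memℓp s ∞ := by
  refine memℓp_infty ⟨C * ‖t‖, ?_⟩
  rintro _ ⟨x, rfl⟩
  exact (h x).trans (by gcongr; exact lp.norm_apply_le_norm ENNReal.top_ne_zero t x)

/-- The isomorphism of spaces of bounded families given by fiberwise isomorphisms with uniform
bounds. -/
noncomputable def lpInftyCongr (e : ∀ x, E x ≃ₗ[𝕜] F x) {C D : ℝ} (hC : 0 ≤ C) (hD : 0 ≤ D)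
    (he : ∀ x v, ‖e x v‖ ≤ C * ‖v‖) (he' : ∀ x v, ‖(e x).symm v‖ ≤ D * ‖v‖) :
    lp E ∞ ≃L[𝕜] lp F ∞ :=
  LinearEquiv.toContinuousLinearEquivOfBounds
    { toFun := fun s => ⟨fun x => e x (s x), memℓp_infty_of_norm_le s hC fun x => he x _⟩
      invFun := fun s =>
        ⟨fun x => (e x).symm (s x), memℓp_infty_of_norm_le s hD fun x => he' x _⟩
      map_add' := fun s t => by ext x; exact map_add (e x) (s x) (t x)
      map_smul' := fun a s => by ext x; exact map_smul (e x) a (s x)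
      left_inv := fun s => by ext x; exact (e x).symm_apply_apply (s x)
      right_inv := fun s => by ext x; exact (e x).apply_symm_apply (s x) }
    C D
    (fun s => lp.norm_le_of_forall_le (by positivity) fun x => (he x _).trans
      (by gcongr; exact lp.norm_apply_le_norm ENNReal.top_ne_zero s x))
    (fun s => lp.norm_le_of_forall_le (by positivity) fun x => (he' x _).trans
      (by gcongr; exact lp.norm_apply_le_norm ENNReal.top_ne_zero s x))

end SectionSpaces

section RenormingSections

universe u v

variable {𝕜 : Type*} [RCLike 𝕜] {X : Type u} [TopologicalSpace X] {E : X → Type v}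
  [∀ x, NormedAddCommGroup (E x)] [∀ x, NormedSpace 𝕜 (E x)]
  [TopologicalSpace (BundleTotal E)] (R : HilbertRenorming 𝕜 E)

namespace HilbertRenorming

theorem isContinuousSection_iff {s : ∀ x, E x} :
    IsContinuousSection (fun x => R.equiv x (s x)) ↔ IsContinuousSection s :=
  (R.isHomeomorph_equiv.isInducing.continuous_iff (f := fun x => (⟨x, s x⟩ : BundleTotal E))).symm

variable {R} {c : ℝ} (hc : 0 < c) (hcR : ∀ x v, c * ‖v‖ ≤ ‖R.equiv x v‖)
  (hRC : ∀ x v, ‖R.equiv x v‖ ≤ ‖v‖)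

/-- The isomorphism of the spaces of bounded families given by a renorming with uniform bounds. -/
noncomputable def lpCongr : lp E ∞ ≃L[𝕜] lp R.Fiber ∞ :=
  lpInftyCongr R.equiv zero_le_one (inv_nonneg.2 hc.le) (fun x v => by simpa using hRC x v)
    fun x v => by
      rw [le_inv_mul_iff₀ hc]
      simpa using hcR x ((R.equiv x).symm v)

include hc hcR hRC in
theorem tendsto_norm_equiv_iff {s : ∀ x, E x} {l : Filter X} :
    Tendsto (fun x => ‖R.equiv x (s x)‖) l (𝓝 0) ↔ Tendsto (fun x => ‖s x‖) l (𝓝 0) := by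
  refine ⟨fun h => ?_, fun h => squeeze_zero (fun x => norm_nonneg _) (fun x => hRC x _) h⟩
  refine squeeze_zero (fun x => norm_nonneg _)
    (fun x => (le_inv_mul_iff₀ hc).2 (hcR x (s x))) ?_
  simpa using h.const_mul c⁻¹

variable [IsFellBundle 𝕜 E]

theorem map_boundedSections :
    (BoundedSections 𝕜 E).map (lpCongr hc hcR hRC : lp E ∞ →ₗ[𝕜] lp R.Fiber ∞) =
      BoundedSections 𝕜 R.Fiber := by
  ext t
  obtain ⟨s, rfl⟩ := (lpCongr hc hcR hRC).surjective t
  rw [← SetLike.mem_coe]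
  erw [Submodule.map_coe, (lpCongr hc hcR hRC).injective.mem_set_image]
  exact (R.isContinuousSection_iff (s := fun x => s x)).symm

theorem map_zeroSections :
    (ZeroSections 𝕜 E).map (lpCongr hc hcR hRC : lp E ∞ →ₗ[𝕜] lp R.Fiber ∞) =
      ZeroSections 𝕜 R.Fiber := by
  ext t
  obtain ⟨s, rfl⟩ := (lpCongr hc hcR hRC).surjective t
  rw [← SetLike.mem_coe]
  erw [Submodule.map_coe, (lpCongr hc hcR hRC).injective.mem_set_image]
  exact ((R.isContinuousSection_iff (s := fun x => s x)).and
    (tendsto_norm_equiv_iff hc hcR hRC)).symm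

/-- The isomorphism of the spaces of bounded sections. -/
noncomputable def boundedSectionsCongr : BoundedSections 𝕜 E ≃L[𝕜] BoundedSections 𝕜 R.Fiber :=
  (lpCongr hc hcR hRC).ofSubmodules _ _ (map_boundedSections hc hcR hRC)

/-- The isomorphism of the spaces of sections vanishing at infinity. -/
noncomputable def zeroSectionsCongr : ZeroSections 𝕜 E ≃L[𝕜] ZeroSections 𝕜 R.Fiber :=
  (lpCongr hc hcR hRC).ofSubmodules _ _ (map_zeroSections hc hcR hRC)

theorem boundedSectionsCongr_apply (s : BoundedSections 𝕜 E) (x : X) :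
    (boundedSectionsCongr hc hcR hRC s : lp R.Fiber ∞) x = R.equiv x ((s : lp E ∞) x) := rfl

theorem zeroSectionsCongr_apply (s : ZeroSections 𝕜 E) (x : X) :
    (zeroSectionsCongr hc hcR hRC s : lp R.Fiber ∞) x = R.equiv x ((s : lp E ∞) x) := rfl

end HilbertRenorming

end RenormingSections

section Completeness

variable (𝕜 : Type*) [RCLike 𝕜] {X : Type*} [TopologicalSpace X] {E : X → Type*}
  [∀ x, NormedAddCommGroup (E x)] [∀ x, NormedSpace 𝕜 (E x)]
  [TopologicalSpace (BundleTotal E)] [IsFellBundle 𝕜 E]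

include 𝕜 in
/-- A section that is uniformly approximated by continuous sections is continuous. -/
theorem IsContinuousSection.of_uniform_approx {s : ∀ x, E x}
    (h : ∀ ε > 0, ∃ t : ∀ x, E x, IsContinuousSection t ∧ ∀ x, ‖s x - t x‖ ≤ ε) :
    IsContinuousSection s := by
  refine continuous_iff_continuousAt.2 fun x₀ => ?_
  set p : BundleTotal E := ⟨x₀, s x₀⟩
  have hproj : Tendsto (fun q : BundleTotal E => q.proj) (𝓝 p) (𝓝 x₀) :=
    (IsFellBundle.continuous_proj (𝕜 := 𝕜) (E := E)).tendsto p
  have hq : Tendsto (fun q : BundleTotal E => (⟨q.proj, q.snd⟩ : BundleTotal E)) (𝓝 p)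
      (𝓝 ⟨x₀, s x₀⟩) := tendsto_id
  have hdiff : Tendsto (fun q : BundleTotal E => ‖s q.proj - q.snd‖) (𝓝 p) (𝓝 0) := by
    refine (tendsto_order.2 ⟨fun a ha => Eventually.of_forall fun q =>
      ha.trans_le (norm_nonneg _), fun ε hε => ?_⟩)
    obtain ⟨t, ht, hst⟩ := h (ε / 3) (by positivity)
    have ht' : Tendsto (fun q : BundleTotal E => (⟨q.proj, t q.proj⟩ : BundleTotal E)) (𝓝 p)
        (𝓝 ⟨x₀, t x₀⟩) := (ht.tendsto x₀).comp hproj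
    have h1 := IsFellBundle.tendsto_norm 𝕜 (IsFellBundle.tendsto_sub 𝕜 ht' hq)
    have h2 : ‖t x₀ - s x₀‖ < 2 * ε / 3 := by
      rw [norm_sub_rev]
      exact (hst x₀).trans_lt (by linarith)
    filter_upwards [h1.eventually_lt_const h2] with q hq
    calc ‖s q.proj - q.snd‖ ≤ ‖s q.proj - t q.proj‖ + ‖t q.proj - q.snd‖ :=
          norm_sub_le_norm_sub_add_norm_sub _ _ _
      _ < ε / 3 + 2 * ε / 3 := add_lt_add_of_le_of_lt (hst _) hq
      _ = ε := by ring
  have hsum := IsFellBundle.tendsto_add 𝕜 hq (IsFellBundle.tendsto_zero 𝕜 hproj hdiff)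
  simp only [add_sub_cancel, add_zero] at hsum
  have hopen : 𝓝 x₀ ≤ map (fun q : BundleTotal E => q.proj) (𝓝 p) :=
    (IsFellBundle.isOpenMap_proj (𝕜 := 𝕜) (E := E)).nhds_le p
  have hmap : Tendsto (fun x => (⟨x, s x⟩ : BundleTotal E))
      (map (fun q : BundleTotal E => q.proj) (𝓝 p)) (𝓝 ⟨x₀, s x₀⟩) := tendsto_map' hsum
  exact hmap.mono_left hopen

variable (E) in
theorem isClosed_zeroSections : IsClosed (ZeroSections 𝕜 E : Set (lp E ∞)) := by
  refine isClosed_of_closure_subset fun s hs => ?_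
  have happrox : ∀ ε > 0, ∃ t ∈ ZeroSections 𝕜 E, ∀ x, ‖s x - t x‖ ≤ ε := by
    intro ε hε
    obtain ⟨t, ht, hst⟩ := Metric.mem_closure_iff.1 hs ε hε
    refine ⟨t, ht, fun x => ?_⟩
    have h1 := lp.norm_apply_le_norm ENNReal.top_ne_zero (s - t) x
    rw [← dist_eq_norm] at h1
    exact h1.trans hst.le
  refine ⟨IsContinuousSection.of_uniform_approx 𝕜 fun ε hε => ?_, ?_⟩
  · obtain ⟨t, ht, hst⟩ := happrox ε hε
    exact ⟨fun x => t x, ht.1, hst⟩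
  · refine tendsto_order.2 ⟨fun a ha => Eventually.of_forall fun x =>
      ha.trans_le (norm_nonneg _), fun ε hε => ?_⟩
    obtain ⟨t, ht, hst⟩ := happrox (ε / 2) (by positivity)
    filter_upwards [ht.2.eventually_lt_const (half_pos hε)] with x hx
    have := norm_le_norm_add_norm_sub' (s x) (t x)
    linarith [hst x]

variable (E) in
theorem completeSpace_zeroSections : CompleteSpace (ZeroSections 𝕜 E) := by
  have : ∀ x, CompleteSpace (E x) := IsFellBundle.complete_fiber 𝕜
  exact (isClosed_zeroSections 𝕜 E).completeSpace_coe

/-- A `C_0(X)`-valued inner product whose norm is equivalent to the supremum norm makes the space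
of sections a Hilbert module. -/
theorem ZeroSectionsInner.IsEquivalentToSupNorm.isHilbertModule {I : ZeroSectionsInner 𝕜 E}
    (hI : I.IsEquivalentToSupNorm) : I.IsHilbertModule := by
  have := completeSpace_zeroSections 𝕜 E
  obtain ⟨c, hc, C, hC, hcC⟩ := hI
  intro s hs
  have hcauchy : CauchySeq s := by
    refine Metric.cauchySeq_iff.2 fun ε hε => ?_
    obtain ⟨N, hN⟩ := hs (c * ε) (by positivity)
    refine ⟨N, fun m hm n hn => ?_⟩
    rw [dist_eq_norm]
    exact lt_of_mul_lt_mul_left ((hcC _).1.trans_lt (hN m hm n hn)) hc.le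
  obtain ⟨t, ht⟩ := cauchySeq_tendsto_of_complete hcauchy
  refine ⟨t, squeeze_zero (fun n => Real.sqrt_nonneg _) (fun n => (hcC _).2) ?_⟩
  simpa using (tendsto_iff_norm_sub_tendsto_zero.1 ht).const_mul C

end Completeness

section HilbertBundle

variable {𝕜 : Type*} [RCLike 𝕜] {X : Type*} [TopologicalSpace X] {F : X → Type*}
  [∀ x, NormedAddCommGroup (F x)] [∀ x, InnerProductSpace 𝕜 (F x)]
  [TopologicalSpace (BundleTotal F)] [IsFellBundle 𝕜 F]

theorem IsContinuousSection.norm (𝕜 : Type*) [RCLike 𝕜] {E : X → Type*}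
    [∀ x, NormedAddCommGroup (E x)] [∀ x, NormedSpace 𝕜 (E x)]
    [TopologicalSpace (BundleTotal E)] [IsFellBundle 𝕜 E] {s : ∀ x, E x}
    (hs : IsContinuousSection s) : Continuous fun x => ‖s x‖ :=
  (IsFellBundle.continuous_norm (𝕜 := 𝕜) (E := E)).comp hs

theorem IsContinuousSection.inner {s t : ∀ x, F x} (hs : IsContinuousSection s)
    (ht : IsContinuousSection t) : Continuous fun x => inner 𝕜 (s x) (t x) := by
  have key : ∀ c : 𝕜, Continuous fun x => (‖s x + c • t x‖ : 𝕜) := fun c =>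
    RCLike.continuous_ofReal.comp
      ((hs.add 𝕜 (ht.smul 𝕜 (continuous_const (y := c)))).norm 𝕜)
  have h1 := key 1
  have h2 := key (-1)
  have h3 := key (-RCLike.I)
  have h4 := key RCLike.I
  simp only [one_smul, neg_smul, ← sub_eq_add_neg] at h1 h2 h3
  simp only [inner_eq_sum_norm_sq_div_four]
  fun_prop

/-- The pointwise inner product of two sections vanishing at infinity of a Hilbert bundle. -/
noncomputable def ZeroSections.pointwiseInner (s t : ZeroSections 𝕜 F) : C₀(X, 𝕜) where
  toFun x := inner 𝕜 ((s : lp F ∞) x) ((t : lp F ∞) x)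
  continuous_toFun := s.2.1.inner t.2.1
  zero_at_infty' := by
    refine squeeze_zero_norm (fun x => norm_inner_le_norm _ _) ?_
    simpa using s.2.2.mul t.2.2

theorem ZeroSections.pointwiseInner_apply (s t : ZeroSections 𝕜 F) (x : X) :
    pointwiseInner s t x = inner 𝕜 ((s : lp F ∞) x) ((t : lp F ∞) x) := rfl

theorem ZeroSections.sqrt_norm_pointwiseInner_self (s : ZeroSections 𝕜 F) :
    Real.sqrt ‖pointwiseInner s s‖ = ‖s‖ := by
  have hx : ∀ x, ‖pointwiseInner s s x‖ = ‖(s : lp F ∞) x‖ ^ 2 := fun x => by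
    rw [pointwiseInner_apply, inner_self_eq_norm_sq_to_K, norm_pow, RCLike.norm_ofReal, abs_norm]
  refine le_antisymm ?_ ?_
  · rw [Real.sqrt_le_left (norm_nonneg _)]
    refine (BoundedContinuousFunction.norm_le (by positivity)).2 fun x => ?_
    refine (hx x).trans_le ?_
    gcongr
    exact lp.norm_apply_le_norm ENNReal.top_ne_zero (s : lp F ∞) x
  · have h : ∀ x, ‖(s : lp F ∞) x‖ ≤ Real.sqrt ‖pointwiseInner s s‖ := fun x =>
      Real.le_sqrt_of_sq_le ((hx x).symm.trans_le
        ((pointwiseInner s s).toBCF.norm_coe_le_norm x))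
    exact lp.norm_le_of_forall_le (Real.sqrt_nonneg _) h

end HilbertBundle

section UnitarizableOfBounds

universe u v

variable {𝕜 : Type*} [RCLike 𝕜] {X : Type u} [TopologicalSpace X] {E : X → Type v}
  [∀ x, NormedAddCommGroup (E x)] [∀ x, NormedSpace 𝕜 (E x)]
  [TopologicalSpace (BundleTotal E)] [IsFellBundle 𝕜 E] {R : HilbertRenorming 𝕜 E}
  {c : ℝ} (hc : 0 < c) (hcR : ∀ x v, c * ‖v‖ ≤ ‖R.equiv x v‖)
  (hRC : ∀ x v, ‖R.equiv x v‖ ≤ ‖v‖)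

/-- The inner product on sections of `E` pulled back from a renorming. -/
noncomputable def HilbertRenorming.zeroSectionsInner : ZeroSectionsInner 𝕜 E where
  inner s t := ZeroSections.pointwiseInner (zeroSectionsCongr hc hcR hRC s)
    (zeroSectionsCongr hc hcR hRC t)
  inner_add_right s t₁ t₂ := by
    ext x
    rw [map_add]
    exact inner_add_right _ _ _
  inner_smul_right a s t := by
    ext x
    rw [map_smul]
    exact inner_smul_right _ _ _
  inner_module_smul_right f s t := by
    ext x
    have h : (zeroSectionsCongr hc hcR hRC (f • t) : lp R.Fiber ∞) x =
        f x • (zeroSectionsCongr hc hcR hRC t : lp R.Fiber ∞) x :=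
      map_smul (R.equiv x) (f x) ((t : lp E ∞) x)
    rw [ZeroSections.pointwiseInner_apply, h, inner_smul_right]
    rfl
  star_inner s t := by
    ext x
    exact inner_conj_symm _ _
  inner_self_nonneg s x := by
    rw [ZeroSections.pointwiseInner_apply, inner_self_eq_norm_sq_to_K, ← RCLike.ofReal_pow]
    exact RCLike.ofReal_nonneg.2 (by positivity)
  inner_self_eq_zero s hs := by
    have h := ZeroSections.sqrt_norm_pointwiseInner_self (zeroSectionsCongr hc hcR hRC s)
    rw [hs, norm_zero, Real.sqrt_zero, eq_comm, norm_eq_zero] at h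
    exact (map_eq_zero_iff _ (zeroSectionsCongr hc hcR hRC).injective).1 h

theorem HilbertRenorming.norm_zeroSectionsInner (s : ZeroSections 𝕜 E) :
    (zeroSectionsInner hc hcR hRC).norm s = ‖zeroSectionsCongr hc hcR hRC s‖ :=
  ZeroSections.sqrt_norm_pointwiseInner_self _

theorem HilbertRenorming.isEquivalentToSupNorm_zeroSectionsInner :
    (zeroSectionsInner hc hcR hRC).IsEquivalentToSupNorm := by
  refine ⟨c, hc, 1, one_pos, fun s => ?_⟩
  rw [norm_zeroSectionsInner, one_mul]
  have happly : ∀ x, ‖R.equiv x ((s : lp E ∞) x)‖ ≤ ‖zeroSectionsCongr hc hcR hRC s‖ := fun x =>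
    lp.norm_apply_le_norm ENNReal.top_ne_zero (zeroSectionsCongr hc hcR hRC s : lp R.Fiber ∞) x
  constructor
  · rw [← le_inv_mul_iff₀ hc]
    have h : ∀ x, ‖(s : lp E ∞) x‖ ≤ c⁻¹ * ‖zeroSectionsCongr hc hcR hRC s‖ := fun x =>
      (le_inv_mul_iff₀ hc).2 ((hcR x _).trans (happly x))
    exact lp.norm_le_of_forall_le (by positivity) h
  · have h : ∀ x, ‖(zeroSectionsCongr hc hcR hRC s : lp R.Fiber ∞) x‖ ≤ ‖s‖ := fun x =>
      (hRC x _).trans (lp.norm_apply_le_norm ENNReal.top_ne_zero (s : lp E ∞) x)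
    exact lp.norm_le_of_forall_le (norm_nonneg _) h

end UnitarizableOfBounds

theorem mainTheorem9 {𝕜 : Type*} [RCLike 𝕜] {X : Type*} [TopologicalSpace X] [T2Space X]
    (E : X → Type*) [∀ x, NormedAddCommGroup (E x)] [∀ x, NormedSpace 𝕜 (E x)]
    [TopologicalSpace (BundleTotal E)] [IsFellBundle 𝕜 E]
    (n : ℕ) (hE : IsHomogeneousBundle 𝕜 E n) :
    (IsLocallyParacompact X → IsBoundedlyUnitarizable 𝕜 E) ∧
    (LocallyCompactSpace X →
      IsZeroBoundedlyUnitarizable 𝕜 E ∧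
      ∃ I : ZeroSectionsInner 𝕜 E, I.IsHilbertModule ∧ I.IsEquivalentToSupNorm) := by
  obtain ⟨R, c, hc, hcR, hRC⟩ := exists_hilbertRenorming_bounds 𝕜 E hE
  have hI := HilbertRenorming.isEquivalentToSupNorm_zeroSectionsInner hc hcR hRC
  exact ⟨fun _ => ⟨R, R.boundedSectionsCongr hc hcR hRC, R.boundedSectionsCongr_apply hc hcR hRC⟩,
    fun _ => ⟨⟨R, R.zeroSectionsCongr hc hcR hRC, R.zeroSectionsCongr_apply hc hcR hRC⟩,
      _, hI.isHilbertModule, hI⟩⟩
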